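/- Let $R$ be a commutative ring, $B$ an associative unital $R$-algebra, and $B^e=B\otimes_R B^{\circ}$, so that $R$-central $B$-bimodules are the same as left (or right) $B^e$-modules. Put $$HH^i(B)=H^i(\mathrm{RHom}_{B^e}(B,B))=\mathrm{Hom}_{D(B^e)}(B,\Sigma^i B),\qquad HH_i(B)=H^{-i}(B\otimes^{L}_{B^e}B)\qquad(i\in\mathbb Z),$$ and let $\cap: HH^i(B)\times HH_d(B)\to HH_{d-i}(B)$, $(\mu,\eta)\mapsto\mu\cap\eta$, be the cap product, i.e. the action of $\mu:B\to\Sigma^iB$ on $B\otimes^{L}_{B^e}B$ through one of the two factors. Here, up to sign, this is computed as follows: if $P\to B$ is a projective resolution over $B^e$, then $HH_\bullet(B)$ is the homology of $P\otimes_{B^e}B$, and $\mu\cap-$ is induced by $f\otimes\mathrm{id}_B$ for any map of complexes $f:P\to\Sigma^iP$ representing $\mu$. Call $B$ homologically smooth over $R$ if $B$ is flat over $R$ and has a finite resolution by finitely generated projective $B^e$-modules. For $d\in\mathbb Z$, evaluation $p\otimes b\mapsto(\varphi\mapsto b\cdot\varphi(p))$ on $P\otimes_{B^e}B$ induces a canonical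 map $$HH_d(B)\longrightarrow \mathrm{Hom}_{D(B^e)}(\mathrm{RHom}_{B^e}(B,B^e),\Sigma^{-d}B),\qquad \eta\mapsto\eta^+,$$ and $\eta\in HH_d(B)$ is called nondegenerate if $\eta^+$ is an isomorphism in $D(B^e)$. A $d$-Calabi-Yau $R$-algebra is a pair $(B,\eta)$ with $B$ a homologically smooth $R$-algebra and $\eta\in HH_d(B)$ nondegenerate. **Proposition (Poincaré duality).** Let $(B,\eta)$ be a $d$-Calabi-Yau $R$-algebra. Then for every $i\in\mathbb Z$ the map $$HH^i(B)\longrightarrow HH_{d-i}(B),\qquad \mu\mapsto\mu\cap\eta,$$ is an isomorphism of $R$-modules. Consequently $HH^i(B)=0$ and $HH_i(B)=0$ for every integer $i\notin[0,d]$. -/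

import Mathlib

open CategoryTheory TensorProduct MulOpposite

universe w u v

noncomputable section

namespace HochschildDuality

/-! ### The enveloping algebra -/

section Envelope

variable (R : Type u) [CommRing R] (B : Type v) [Ring B] [Algebra R B]

/-- The enveloping algebra `Bᵉ = B ⊗_R Bᵒᵖ`.  Left `Bᵉ`-modules are the `R`-central
`B`-bimodules: `(x ⊗ op y) • m` is `x m y`. -/
abbrev Env : Type v := B ⊗[R] Bᵐᵒᵖ

/-- The canonical anti-automorphism `x ⊗ op y ↦ y ⊗ op x` of `Bᵉ`, as an isomorphism onto the
opposite algebra.  It identifies left and right `Bᵉ`-modules. -/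
def envFlip : Env R B ≃ₐ[R] (Env R B)ᵐᵒᵖ :=
  (Algebra.TensorProduct.comm R B Bᵐᵒᵖ).trans
    ((Algebra.TensorProduct.congr AlgEquiv.refl (AlgEquiv.opOp R B)).trans
      (Algebra.TensorProduct.opAlgEquiv R R B Bᵐᵒᵖ))

/-- `envFlip` written as a map `Bᵉ → Bᵉ`; it is `R`-linear and reverses products. -/
def envSwap : Env R B →ₗ[R] Env R B :=
  (MulOpposite.opLinearEquiv R).symm.toLinearMap ∘ₗ (envFlip R B).toLinearMap

lemma envSwap_tmul (x : B) (y : Bᵐᵒᵖ) :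
    envSwap R B (x ⊗ₜ[R] y) = y.unop ⊗ₜ[R] op x := rfl

lemma op_envSwap (s : Env R B) : op (envSwap R B s) = envFlip R B s := rfl

lemma envSwap_mul (s t : Env R B) : envSwap R B (s * t) = envSwap R B t * envSwap R B s := by
  apply MulOpposite.op_injective
  rw [op_envSwap, map_mul, op_mul, op_envSwap, op_envSwap]

lemma envSwap_envSwap (s : Env R B) : envSwap R B (envSwap R B s) = s := by
  induction s using TensorProduct.induction_on with
  | zero => simp
  | tmul x y => simp [envSwap_tmul]
  | add a b ha hb => simp [ha, hb]

/-- `B` as a left `Bᵉ`-module, `(x ⊗ op y) • b = x b y`. -/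
instance instModuleEnv : Module (Env R B) B := TensorProduct.Algebra.module

lemma env_smul_def (x : B) (y : Bᵐᵒᵖ) (b : B) :
    (x ⊗ₜ[R] y : Env R B) • b = x * b * y.unop := by
  rw [mul_assoc]; rfl

instance instIsScalarTowerEnv : IsScalarTower R (Env R B) B where
  smul_assoc r s b := by
    change TensorProduct.Algebra.moduleAux (r • s) b = r • TensorProduct.Algebra.moduleAux s b
    rw [map_smul]
    rfl

/-- The bimodule `B`, as an object of the category of `Bᵉ`-modules. -/
abbrev diag : ModuleCat.{v} (Env R B) := ModuleCat.of (Env R B) B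

/-! ### The tensor product `M ⊗_{Bᵉ} B` -/

section Tensor

variable (M : Type v) [AddCommGroup M] [Module R M] [Module (Env R B) M]

/-- The relations `m s ⊗ b = m ⊗ s b` for `s ∈ Bᵉ`, where `M` is regarded as a right
`Bᵉ`-module through the canonical anti-automorphism of `Bᵉ`. -/
def tensorRel : Submodule R (M ⊗[R] B) :=
  Submodule.span R {t | ∃ (m : M) (s : Env R B) (b : B),
    t = (envSwap R B s • m) ⊗ₜ[R] b - m ⊗ₜ[R] (s • b)}

/-- The `R`-module `M ⊗_{Bᵉ} B`. -/
abbrev TensorDiag : Type v := (M ⊗[R] B) ⧸ tensorRel R B M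

variable {M}

/-- The class of `m ⊗ b` in `M ⊗_{Bᵉ} B`. -/
def tmk (m : M) (b : B) : TensorDiag R B M := Submodule.Quotient.mk (m ⊗ₜ[R] b)

variable {R B}

@[elab_as_elim]
lemma TensorDiag.induction {p : TensorDiag R B M → Prop} (h0 : p 0)
    (ht : ∀ m b, p (tmk R B m b)) (ha : ∀ x y, p x → p y → p (x + y))
    (z : TensorDiag R B M) : p z := by
  obtain ⟨z, rfl⟩ := Submodule.Quotient.mk_surjective _ z
  induction z using TensorProduct.induction_on with
  | zero => exact h0
  | tmul m b => exact ht m b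
  | add a c hha hhc => exact ha _ _ hha hhc

lemma tmk_smul (m : M) (s : Env R B) (b : B) :
    tmk R B (envSwap R B s • m) b = tmk R B m (s • b) :=
  (Submodule.Quotient.eq _).2 (Submodule.subset_span ⟨m, s, b, rfl⟩)

variable {N : Type v} [AddCommGroup N] [Module R N] [Module (Env R B) N]
  [IsScalarTower R (Env R B) M] [IsScalarTower R (Env R B) N]

/-- The map `f ⊗ B : M ⊗_{Bᵉ} B → N ⊗_{Bᵉ} B` induced by a `Bᵉ`-linear map `f`. -/
def TensorDiag.map (f : M →ₗ[Env R B] N) : TensorDiag R B M →ₗ[R] TensorDiag R B N :=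
  (tensorRel R B M).mapQ (tensorRel R B N) ((f.restrictScalars R).rTensor B) (by
    refine Submodule.span_le.2 ?_
    rintro _ ⟨m, s, b, rfl⟩
    refine Submodule.subset_span ⟨f m, s, b, ?_⟩
    simp)

lemma TensorDiag.map_tmk (f : M →ₗ[Env R B] N) (m : M) (b : B) :
    TensorDiag.map f (tmk R B m b) = tmk R B (f m) b := rfl

lemma TensorDiag.map_id :
    TensorDiag.map (LinearMap.id : M →ₗ[Env R B] M) = (LinearMap.id : _ →ₗ[R] TensorDiag R B M) := by
  refine LinearMap.ext fun x => ?_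
  induction x using TensorDiag.induction with
  | h0 => simp
  | ht m b => rfl
  | ha a c ha hc => rw [_root_.map_add, ha, hc, _root_.map_add]

lemma TensorDiag.map_comp {L : Type v} [AddCommGroup L] [Module R L] [Module (Env R B) L]
    [IsScalarTower R (Env R B) L] (f : M →ₗ[Env R B] N) (g : N →ₗ[Env R B] L) :
    TensorDiag.map (g.comp f) = (TensorDiag.map g).comp (TensorDiag.map f) := by
  refine LinearMap.ext fun x => ?_
  induction x using TensorDiag.induction with
  | h0 => simp
  | ht m b => rfl
  | ha a c ha hc => rw [_root_.map_add, ha, hc, _root_.map_add]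

lemma TensorDiag.map_add (f g : M →ₗ[Env R B] N) :
    TensorDiag.map (f + g) = TensorDiag.map f + TensorDiag.map g := by
  refine LinearMap.ext fun x => ?_
  induction x using TensorDiag.induction with
  | h0 => simp
  | ht m b =>
    exact congrArg (Submodule.Quotient.mk (p := tensorRel R B N))
      (TensorProduct.add_tmul (f m) (g m) b)
  | ha a c ha hc => rw [_root_.map_add, ha, hc, _root_.map_add]

end Tensor

/-! ### The dual `Hom_{Bᵉ}(M, Bᵉ)` -/

section Dual

/-- `Hom_{Bᵉ}(M, Bᵉ)`. -/
def Dual (M : Type v) [AddCommGroup M] [Module (Env R B) M] : Type v :=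
  M →ₗ[Env R B] Env R B

variable {R B}
variable {M N : Type v} [AddCommGroup M] [Module (Env R B) M]
  [AddCommGroup N] [Module (Env R B) N]

instance : AddCommGroup (Dual R B M) := inferInstanceAs (AddCommGroup (M →ₗ[Env R B] Env R B))

instance : FunLike (Dual R B M) M (Env R B) :=
  inferInstanceAs (FunLike (M →ₗ[Env R B] Env R B) M (Env R B))

instance : LinearMapClass (Dual R B M) (Env R B) M (Env R B) :=
  inferInstanceAs (LinearMapClass (M →ₗ[Env R B] Env R B) (Env R B) M (Env R B))

/-- An element of `Dual R B M`, as a linear map. -/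
def Dual.toLin (φ : Dual R B M) : M →ₗ[Env R B] Env R B := φ

lemma Dual.toLin_apply (φ : Dual R B M) (m : M) : φ.toLin m = φ m := rfl

lemma Dual.ext {φ ψ : Dual R B M} (h : ∀ m, φ m = ψ m) : φ = ψ := DFunLike.ext φ ψ h

lemma Dual.add_apply (φ ψ : Dual R B M) (m : M) : (φ + ψ) m = φ m + ψ m := rfl

lemma Dual.zero_apply (m : M) : (0 : Dual R B M) m = 0 := rfl

/-- The right `Bᵉ`-module structure `(φ s)(m) = φ(m) s`, regarded as a left `Bᵉ`-module
structure through the canonical anti-automorphism of `Bᵉ`. -/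
instance : Module (Env R B) (Dual R B M) :=
  letI : Module (Env R B)ᵐᵒᵖ (Dual R B M) :=
    inferInstanceAs (Module (Env R B)ᵐᵒᵖ (M →ₗ[Env R B] Env R B))
  Module.compHom (Dual R B M) (envFlip R B : Env R B →+* (Env R B)ᵐᵒᵖ)

lemma Dual.smul_apply (s : Env R B) (φ : Dual R B M) (m : M) :
    (s • φ) m = φ m * envSwap R B s := rfl

/-- The dual `N^∨ → M^∨`, `φ ↦ φ ∘ f`, of a map `f : M → N`. -/
def Dual.map (f : M →ₗ[Env R B] N) : Dual R B N →ₗ[Env R B] Dual R B M where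
  toFun φ := φ.toLin.comp f
  map_add' _ _ := rfl
  map_smul' _ _ := rfl

lemma Dual.map_apply (f : M →ₗ[Env R B] N) (φ : Dual R B N) (m : M) :
    Dual.map f φ m = φ (f m) := rfl

/-! ### Evaluation `M ⊗_{Bᵉ} B → Hom_{Bᵉ}(Hom_{Bᵉ}(M, Bᵉ), B)` -/

variable [Module R M] [IsScalarTower R (Env R B) M] [Module R N] [IsScalarTower R (Env R B) N]

/-- For `φ : M → Bᵉ`, the `R`-linear map `M ⊗_{Bᵉ} B → B`, `m ⊗ b ↦ b · φ(m)`, where `B` is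
regarded as a right `Bᵉ`-module through the canonical anti-automorphism of `Bᵉ`. -/
def evalAt (φ : Dual R B M) : TensorDiag R B M →ₗ[R] B :=
  (tensorRel R B M).liftQ
    (TensorProduct.lift
      ((Algebra.lsmul R R B (A := Env R B)).toLinearMap ∘ₗ
        (envSwap R B ∘ₗ LinearMap.restrictScalars R φ.toLin))) (by
    refine Submodule.span_le.2 ?_
    rintro _ ⟨m, s, b, rfl⟩
    simp [envSwap_mul, envSwap_envSwap])

lemma evalAt_tmk (φ : Dual R B M) (m : M) (b : B) :
    evalAt φ (tmk R B m b) = envSwap R B (φ m) • b := rfl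

/-- The canonical map `M ⊗_{Bᵉ} B → Hom_{Bᵉ}(Hom_{Bᵉ}(M, Bᵉ), B)`. -/
def evalDual (z : TensorDiag R B M) : Dual R B M →ₗ[Env R B] B where
  toFun φ := evalAt φ z
  map_add' φ ψ := by
    induction z using TensorDiag.induction with
    | h0 => simp
    | ht m b => simp only [evalAt_tmk, Dual.add_apply, map_add, add_smul]
    | ha a c ha hc => simp only [map_add, ha, hc]; abel
  map_smul' s φ := by
    induction z using TensorDiag.induction with
    | h0 => simp
    | ht m b => simp only [evalAt_tmk, Dual.smul_apply, envSwap_mul, envSwap_envSwap, mul_smul,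
        RingHom.id_apply]
    | ha a c ha hc => rw [map_add, map_add, ha, hc, smul_add]

lemma evalDual_apply (z : TensorDiag R B M) (φ : Dual R B M) : evalDual z φ = evalAt φ z := rfl

lemma evalDual_comp_map (f : M →ₗ[Env R B] N) (z : TensorDiag R B M) :
    (evalDual z).comp (Dual.map f) = evalDual (TensorDiag.map f z) := by
  ext φ
  rw [LinearMap.comp_apply, evalDual_apply, evalDual_apply]
  induction z using TensorDiag.induction with
  | h0 => simp
  | ht m b => rfl
  | ha a c ha hc => simp only [map_add, ha, hc]

end Dual

/-! ### The same constructions on the category of `Bᵉ`-modules -/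

section Bundled

variable {R B}

/-- The `R`-module underlying a `Bᵉ`-module. -/
abbrev baseModule (M : ModuleCat.{v} (Env R B)) : Module R M :=
  Module.restrictScalars R (Env R B) M

attribute [local instance] baseModule

lemma baseModule_tower (M : ModuleCat.{v} (Env R B)) : IsScalarTower R (Env R B) M :=
  IsScalarTower.restrictScalars R (Env R B) M

attribute [local instance] baseModule_tower

/-- The category of `Bᵉ`-modules is `R`-linear. -/
instance instLinearEnv : Linear R (ModuleCat.{v} (Env R B)) where
  homModule _ _ := inferInstance

variable (R B) in
/-- The functor `- ⊗_{Bᵉ} B` from `Bᵉ`-modules to `R`-modules. -/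
def tensorDiag : ModuleCat.{v} (Env R B) ⥤ ModuleCat.{v} R where
  obj M := ModuleCat.of R (TensorDiag R B M)
  map f := ModuleCat.ofHom (TensorDiag.map f.hom)
  map_id _ := ModuleCat.hom_ext TensorDiag.map_id
  map_comp f g := ModuleCat.hom_ext (TensorDiag.map_comp f.hom g.hom)

instance : (tensorDiag R B).Additive where
  map_add {_ _ f g} := ModuleCat.hom_ext (TensorDiag.map_add f.hom g.hom)

/-- The dual complex `Hom_{Bᵉ}(K, Bᵉ)` of a cochain complex `K`, with
`Hom_{Bᵉ}(K^{-n}, Bᵉ)` in cohomological degree `n`. -/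
def dualComplex (K : CochainComplex (ModuleCat.{v} (Env R B)) ℤ) :
    CochainComplex (ModuleCat.{v} (Env R B)) ℤ where
  X n := ModuleCat.of (Env R B) (Dual R B (K.X (-n)))
  d i j := ModuleCat.ofHom (Dual.map (K.d (-j) (-i)).hom)
  shape i j h := by
    rw [K.shape _ _ (by simp only [ComplexShape.up_Rel] at h ⊢; omega)]
    ext φ
    exact Dual.ext fun m => map_zero φ
  d_comp_d' i j k _ _ := by
    ext φ
    refine Dual.ext fun m => ?_
    change φ ((K.d (-j) (-i)).hom ((K.d (-k) (-j)).hom m)) = 0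
    have h := congrArg (fun f => f.hom m) (K.d_comp_d (-k) (-j) (-i))
    change (K.d (-j) (-i)).hom ((K.d (-k) (-j)).hom m) = 0 at h
    rw [h, map_zero]

/-- An element `z ∈ K^{-d} ⊗_{Bᵉ} B` with `∂z = 0` gives, by evaluation, a map of complexes
`K^∨ → B[-d]`; here `B[-d]` is `B` placed in cohomological degree `d`. -/
def evalChain (K : CochainComplex (ModuleCat.{v} (Env R B)) ℤ) (d : ℤ)
    (z : TensorDiag R B (K.X (-d)))
    (hz : ∀ j, TensorDiag.map (K.d (-d) j).hom z = 0) :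
    dualComplex K ⟶ (CochainComplex.singleFunctor (ModuleCat.{v} (Env R B)) d).obj (diag R B) :=
  HomologicalComplex.mkHomToSingle
    (ModuleCat.ofHom (evalDual z) : (dualComplex K).X d ⟶ diag R B) (by
      intro i _
      refine ModuleCat.hom_ext ?_
      change (evalDual z).comp (Dual.map (K.d (-d) (-i)).hom) = 0
      rw [evalDual_comp_map]
      rw [hz (-i)]
      ext φ
      exact map_zero (evalAt φ))

/-- Replacing `z` by a homologous cycle does not change the map of complexes up to homotopy. -/
lemma evalChain_homotopy (K : CochainComplex (ModuleCat.{v} (Env R B)) ℤ) (d : ℤ)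
    (z z' : TensorDiag R B (K.X (-d)))
    (hz : ∀ j, TensorDiag.map (K.d (-d) j).hom z = 0)
    (hz' : ∀ j, TensorDiag.map (K.d (-d) j).hom z' = 0)
    (y : TensorDiag R B (K.X (-(d + 1))))
    (hy : z = TensorDiag.map (K.d (-(d + 1)) (-d)).hom y + z') :
    Nonempty (Homotopy (evalChain K d z hz) (evalChain K d z' hz')) := by
  let g : (dualComplex K).X (d + 1) ⟶ diag R B := ModuleCat.ofHom (evalDual y)
  refine ⟨(CochainComplex.HomComplex.Cochain.equivHomotopy _ _).symm
    ⟨CochainComplex.HomComplex.Cochain.toSingleMk g (by omega), ?_⟩⟩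
  rw [CochainComplex.HomComplex.Cochain.δ_toSingleMk g (by omega) 0 d (by omega)]
  apply (CochainComplex.HomComplex.Cochain.toSingleEquiv (p := d) (add_zero d)).injective
  rw [map_add, Int.negOnePow_zero, one_smul,
    CochainComplex.HomComplex.Cochain.toSingleEquiv_toSingleMk]
  have key : ∀ (x : TensorDiag R B (K.X (-d)))
      (hx : ∀ j, TensorDiag.map (K.d (-d) j).hom x = 0),
      CochainComplex.HomComplex.Cochain.toSingleEquiv (p := d) (add_zero d)
        (CochainComplex.HomComplex.Cochain.ofHom (evalChain K d x hx)) =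
        (ModuleCat.ofHom (evalDual x) : (dualComplex K).X d ⟶ diag R B) := by
    intro x hx
    change (CochainComplex.HomComplex.Cochain.ofHom (evalChain K d x hx)).v d d (add_zero d) ≫
      (HomologicalComplex.singleObjXSelf (.up ℤ) d (diag R B)).hom = _
    rw [CochainComplex.HomComplex.Cochain.ofHom_v]
    refine (congrArg (· ≫ _) (HomologicalComplex.mkHomToSingle_f _ _)).trans ?_
    exact (Category.assoc _ _ _).trans ((congrArg (_ ≫ ·) (Iso.inv_hom_id _)).trans
      (Category.comp_id _))
  rw [key, key]
  refine ModuleCat.hom_ext ?_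
  change evalDual z = (evalDual y).comp (Dual.map (K.d (-(d + 1)) (-d)).hom) + evalDual z'
  rw [evalDual_comp_map, hy]
  ext φ
  exact map_add (evalAt φ) _ _

end Bundled

end Envelope

/-! ### Hochschild homology and cohomology -/

section Hochschild

attribute [local instance] baseModule baseModule_tower

variable (R : Type u) [CommRing R] (B : Type v) [Ring B] [Algebra R B]

/-- A resolution `P` of `B` by projective `Bᵉ`-modules, as a complex in degrees `≤ 0`. -/
def res : CochainComplex (ModuleCat.{v} (Env R B)) ℤ :=
  (projectiveResolution (diag R B)).cochainComplex

/-- The augmentation `P → B`, a quasi-isomorphism. -/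
def resAug : res R B ⟶ (CochainComplex.singleFunctor _ 0).obj (diag R B) :=
  (projectiveResolution (diag R B)).π'

instance : QuasiIso (resAug R B) :=
  inferInstanceAs (QuasiIso (projectiveResolution (diag R B)).π')

instance : (res R B).IsKProjective :=
  inferInstanceAs (projectiveResolution (diag R B)).cochainComplex.IsKProjective

/-- The complex `P ⊗_{Bᵉ} B`, which computes `B ⊗ᴸ_{Bᵉ} B`. -/
def tensorComplex : CochainComplex (ModuleCat.{v} R) ℤ :=
  ((tensorDiag R B).mapHomologicalComplex (.up ℤ)).obj (res R B)

/-- Hochschild homology `HH_i(B) = H^{-i}(B ⊗ᴸ_{Bᵉ} B)`. -/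
abbrev HHlower (i : ℤ) : ModuleCat.{v} R := (tensorComplex R B).homology (-i)

/-- `B` is homologically smooth over `R`: it is `R`-flat, and as a `Bᵉ`-module it has a finite
resolution by finitely generated projective modules. -/
def HomologicallySmooth : Prop :=
  Module.Flat R B ∧ ∃ P : ProjectiveResolution (diag R B),
    (∀ n, Module.Finite (Env R B) (P.complex.X n)) ∧
      ∃ N, ∀ n, N < n → Limits.IsZero (P.complex.X n)

variable {R B}

/-- The map `HH_d(B) → HH_{d-i}(B)` induced by `f ⊗ B`, for `f : P → Σ^i P`. -/
def capChain {i : ℤ} (f : ShiftedHom (res R B) (res R B) i) (d : ℤ) :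
    HHlower R B d ⟶ HHlower R B (d - i) :=
  (HomologicalComplex.homologyFunctor (ModuleCat.{v} R) (.up ℤ) 0).shiftMap
    (f.map ((tensorDiag R B).mapHomologicalComplex (.up ℤ))) (-d) (-(d - i)) (by ring)

lemma capChain_eq_of_homotopy {i : ℤ} {f g : ShiftedHom (res R B) (res R B) i}
    (h : Homotopy f g) (d : ℤ) : capChain f d = capChain g d := by
  have e : (HomologicalComplex.homologyFunctor (ModuleCat.{v} R) (.up ℤ) (-d)).map
        (((tensorDiag R B).mapHomologicalComplex (.up ℤ)).map f) =
      (HomologicalComplex.homologyFunctor (ModuleCat.{v} R) (.up ℤ) (-d)).map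
        (((tensorDiag R B).mapHomologicalComplex (.up ℤ)).map g) :=
    ((tensorDiag R B).mapHomotopy h).homologyMap_eq (-d)
  change (HomologicalComplex.homologyFunctor (ModuleCat.{v} R) (.up ℤ) (-d)).map (_ ≫ _) ≫ _ =
    (HomologicalComplex.homologyFunctor (ModuleCat.{v} R) (.up ℤ) (-d)).map (_ ≫ _) ≫ _
  rw [Functor.map_comp, Functor.map_comp, e]

/-- The element of `P^{-d} ⊗_{Bᵉ} B` underlying a cycle. -/
def cycleElt {d : ℤ} (z : (tensorComplex R B).cycles (-d)) :
    TensorDiag R B ((res R B).X (-d)) :=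
  (tensorComplex R B).iCycles (-d) z

lemma cycleElt_d {d : ℤ} (z : (tensorComplex R B).cycles (-d)) (j : ℤ) :
    TensorDiag.map ((res R B).d (-d) j).hom (cycleElt z) = 0 := by
  have h := congrArg (fun f => f.hom z) ((tensorComplex R B).iCycles_d (-d) j)
  exact h

lemma exists_cycle {d : ℤ} (η : HHlower R B d) :
    ∃ z : (tensorComplex R B).cycles (-d), (tensorComplex R B).homologyπ (-d) z = η :=
  (ModuleCat.epi_iff_surjective _).1 inferInstance η

lemma exists_boundary {d : ℤ} {z z' : (tensorComplex R B).cycles (-d)}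
    (h : (tensorComplex R B).homologyπ (-d) z = (tensorComplex R B).homologyπ (-d) z') :
    ∃ y : TensorDiag R B ((res R B).X (-(d + 1))),
      cycleElt z = TensorDiag.map ((res R B).d (-(d + 1)) (-d)).hom y + cycleElt z' := by
  have hx : (ShortComplex.mk ((tensorComplex R B).toCycles (-(d + 1)) (-d))
      ((tensorComplex R B).homologyπ (-d)) (by simp)).Exact :=
    ShortComplex.exact_of_g_is_cokernel _
      ((tensorComplex R B).homologyIsCokernel (-(d + 1)) (-d)
        (by rw [CochainComplex.prev]; ring))
  obtain ⟨y, hy⟩ := (ShortComplex.moduleCat_exact_iff _).1 hx (z - z') (by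
    change (tensorComplex R B).homologyπ (-d) (z - z') = 0
    rw [map_sub, h, sub_self])
  refine ⟨y, ?_⟩
  have h2 := congrArg (fun f => f.hom y)
    ((tensorComplex R B).toCycles_i (-(d + 1)) (-d))
  change (tensorComplex R B).iCycles (-d) ((tensorComplex R B).toCycles (-(d + 1)) (-d) y) =
    TensorDiag.map ((res R B).d (-(d + 1)) (-d)).hom y at h2
  rw [← h2]
  change (tensorComplex R B).iCycles (-d) z = _ + (tensorComplex R B).iCycles (-d) z'
  replace hy : (tensorComplex R B).toCycles (-(d + 1)) (-d) y = z - z' := hy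
  rw [hy, map_sub, sub_add_cancel]

variable (R B)
variable [HasDerivedCategory.{w} (ModuleCat.{v} (Env R B))]

/-- `B` as an object of `D(Bᵉ)`. -/
abbrev diagD : DerivedCategory (ModuleCat.{v} (Env R B)) :=
  (DerivedCategory.singleFunctor _ 0).obj (diag R B)

/-- Hochschild cohomology `HH^i(B) = H^i(RHom_{Bᵉ}(B, B)) = Hom_{D(Bᵉ)}(B, Σ^i B)`. -/
abbrev HHupper (i : ℤ) : Type w := ShiftedHom (diagD R B) (diagD R B) i

/-- The isomorphism `P ≅ B` in `D(Bᵉ)`. -/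
def resIso : DerivedCategory.Q.obj (res R B) ≅ diagD R B :=
  asIso (DerivedCategory.Q.map (resAug R B)) ≪≫
    ((DerivedCategory.singleFunctorIsoCompQ _ 0).app (diag R B)).symm

variable {R B}

/-! ### The cap product -/

/-- The map of complexes `f : P → Σ^i P` represents the class `μ : B → Σ^i B` in `D(Bᵉ)`. -/
def Represents {i : ℤ} (f : ShiftedHom (res R B) (res R B) i) (μ : HHupper R B i) : Prop :=
  f.map DerivedCategory.Q ≫ (resIso R B).hom⟦i⟧' = (resIso R B).hom ≫ μ

/-- Maps between shifts of `P` in `D(Bᵉ)` are homotopy classes of maps of complexes. -/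
lemma Q_map_surjective (L : CochainComplex (ModuleCat.{v} (Env R B)) ℤ)
    (φ : DerivedCategory.Q.obj (res R B) ⟶ DerivedCategory.Q.obj L) :
    ∃ f : res R B ⟶ L, DerivedCategory.Q.map f = φ := by
  obtain ⟨g, hg⟩ := (CochainComplex.IsKProjective.Qh_map_bijective (res R B)
    ((HomotopyCategory.quotient _ _).obj L)).surjective
    ((DerivedCategory.quotientCompQhIso _).hom.app _ ≫ φ ≫
      (DerivedCategory.quotientCompQhIso _).inv.app _)
  obtain ⟨f, rfl⟩ := (HomotopyCategory.quotient _ _).map_surjective g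
  refine ⟨f, ?_⟩
  have := DerivedCategory.quotientCompQhIso_hom_naturality f
  rw [hg] at this
  simpa using this.symm

lemma Q_map_injective {L : CochainComplex (ModuleCat.{v} (Env R B)) ℤ} {f g : res R B ⟶ L}
    (h : DerivedCategory.Q.map f = DerivedCategory.Q.map g) : Nonempty (Homotopy f g) := by
  refine ⟨HomotopyCategory.homotopyOfEq _ _ ?_⟩
  apply (CochainComplex.IsKProjective.Qh_map_bijective (res R B)
    ((HomotopyCategory.quotient _ _).obj L)).injective
  rw [← cancel_mono ((DerivedCategory.quotientCompQhIso _).hom.app L),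
    DerivedCategory.quotientCompQhIso_hom_naturality,
    DerivedCategory.quotientCompQhIso_hom_naturality, h]

/-- Every class in `HH^i(B)` is represented by a map of complexes. -/
lemma exists_represents {i : ℤ} (μ : HHupper R B i) : ∃ f, Represents f μ := by
  obtain ⟨f, hf⟩ := Q_map_surjective ((res R B)⟦i⟧)
    ((resIso R B).hom ≫ μ ≫ (resIso R B).inv⟦i⟧' ≫
      (DerivedCategory.Q.commShiftIso i).inv.app (res R B))
  refine ⟨f, ?_⟩
  simp [Represents, ShiftedHom.map, hf, ← Functor.map_comp]

/-- The map on Hochschild homology depends only on the class in `HH^i(B)`. -/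
lemma capChain_eq {i : ℤ} {f g : ShiftedHom (res R B) (res R B) i} {μ : HHupper R B i}
    (hf : Represents f μ) (hg : Represents g μ) (d : ℤ) : capChain f d = capChain g d := by
  have h := hf.trans hg.symm
  rw [cancel_mono, ShiftedHom.map, ShiftedHom.map, cancel_mono] at h
  exact capChain_eq_of_homotopy (Q_map_injective h).some d

/-- The cap product `μ ∩ η ∈ HH_{d-i}(B)` of `μ ∈ HH^i(B)` and `η ∈ HH_d(B)`: the action of
`μ : B → Σ^i B` on `H^{-d}(B ⊗ᴸ_{Bᵉ} B)` through the resolved factor `B`. -/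
def cap {i d : ℤ} (μ : HHupper R B i) (η : HHlower R B d) : HHlower R B (d - i) :=
  capChain (exists_represents μ).choose d η

lemma cap_eq {i d : ℤ} {f : ShiftedHom (res R B) (res R B) i} {μ : HHupper R B i}
    (hf : Represents f μ) (η : HHlower R B d) : cap μ η = capChain f d η := by
  rw [cap, capChain_eq (exists_represents μ).choose_spec hf]

/-! ### Calabi-Yau algebras -/

variable (R B) in
/-- `RHom_{Bᵉ}(B, Bᵉ)`, as an object of `D(Bᵉ)`. -/
def dualD : DerivedCategory (ModuleCat.{v} (Env R B)) :=
  DerivedCategory.Q.obj (dualComplex (res R B))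

/-- The map `RHom_{Bᵉ}(B, Bᵉ) → Σ^{-d} B` in `D(Bᵉ)` given by evaluation on a cycle of degree `d`
in `P ⊗_{Bᵉ} B`. -/
def cycleToD {d : ℤ} (z : (tensorComplex R B).cycles (-d)) :
    dualD R B ⟶ (DerivedCategory.singleFunctor _ d).obj (diag R B) :=
  DerivedCategory.Q.map (evalChain (res R B) d (cycleElt z) (cycleElt_d z)) ≫
    ((DerivedCategory.singleFunctorIsoCompQ _ d).app (diag R B)).inv

/-- The map in the derived category depends only on the homology class of the cycle. -/
lemma cycleToD_eq {d : ℤ} {z z' : (tensorComplex R B).cycles (-d)}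
    (h : (tensorComplex R B).homologyπ (-d) z = (tensorComplex R B).homologyπ (-d) z') :
    cycleToD z = cycleToD z' := by
  obtain ⟨y, hy⟩ := exists_boundary h
  obtain ⟨H⟩ := evalChain_homotopy (res R B) d _ _ (cycleElt_d z) (cycleElt_d z') y hy
  have e := DerivedCategory.Q_map_eq_of_homotopy _ H
  exact congrArg (· ≫ ((DerivedCategory.singleFunctorIsoCompQ _ d).app (diag R B)).inv) e

/-- The canonical map `HH_d(B) → Hom_{D(Bᵉ)}(RHom_{Bᵉ}(B, Bᵉ), Σ^{-d} B)`, `η ↦ η⁺`. -/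
def toDual {d : ℤ} (η : HHlower R B d) :
    dualD R B ⟶ (DerivedCategory.singleFunctor _ d).obj (diag R B) :=
  cycleToD (exists_cycle η).choose

lemma toDual_homologyπ {d : ℤ} (z : (tensorComplex R B).cycles (-d)) :
    toDual (d := d) ((tensorComplex R B).homologyπ (-d) z) = cycleToD z :=
  cycleToD_eq (exists_cycle _).choose_spec

/-- A class `η ∈ HH_d(B)` is nondegenerate if `η⁺ : RHom_{Bᵉ}(B, Bᵉ) → Σ^{-d} B` is an isomorphism
in `D(Bᵉ)`. -/
def Nondegenerate {d : ℤ} (η : HHlower R B d) : Prop := IsIso (toDual η)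

/-- `(B, η)` is a `d`-Calabi-Yau `R`-algebra: `B` is a homologically smooth `R`-algebra and `η` is
a nondegenerate class in `HH_d(B)`. -/
structure IsCalabiYau {d : ℤ} (η : HHlower R B d) : Prop where
  smooth : HomologicallySmooth R B
  nondegenerate : Nondegenerate η

end Hochschild

end HochschildDuality

end

open HochschildDuality

/-! Let `P` be the chosen projective resolution of `B`. A class `η ∈ H^{-d}(P ⊗ B)` defines, by
Yoneda, a natural map `Hom(P, Q) → H^{-d}(Q ⊗ B)`, `f ↦ (f ⊗ B)(η)`, for `Q` in the homotopy
category of `Bᵉ`-modules. Both sides are homological functors of `Q`. For `Q = Σ^i P` the source is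
`HH^i(B)`, because `P` is K-projective, the target is `HH_{d-i}(B)`, and the map is the cap product
with `η`. It therefore suffices to prove that the natural map is bijective at the shifts of `P`.

For `Q = Bᵉ[-k]` the source is the cohomology of the dual complex `P^∨` in degree `-k`. The target
is `B` if `k = -d` and zero otherwise, since `Bᵉ ⊗ B ≅ B`. Under these identifications the map is
the one induced by `η⁺` on cohomology, so nondegeneracy is exactly what makes it bijective
(`bijective_envSingle`).

The objects at all of whose shifts the map is bijective are closed under extensions, by the five
lemma (`evalBijective.ext_of_distinguished`), and bijectivity passes to summands of finite sums
(`yonedaEval_bijective_of_sum`). Bounded complexes of finitely generated projectives are thus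
covered (`of_bounded`), and smoothness makes `P` homotopy equivalent to one of them
(`evalBijective_res`).

Vanishing in negative degrees is clear for both `HH^i` and `HH_i`; duality carries it to degrees
above `d`. -/

noncomputable section

namespace HochschildDuality

/-! ### Evaluating a homological functor at a fixed element -/

section YonedaEval

open Limits Pretriangulated

variable {R : Type u} [Ring R] {C : Type*} [Category* C] [Preadditive C]

/-- The Yoneda transformation `Hom(P, Q) → G(Q)`, `f ↦ G(f)(x)`, attached to `x ∈ G(P)`. -/
def yonedaEval (G : C ⥤ ModuleCat.{v} R) [G.Additive] {P : C} (x : G.obj P) (Q : C) :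
    (P ⟶ Q) →+ G.obj Q where
  toFun f := G.map f x
  map_zero' := by simp
  map_add' f g := by simp

variable (G : C ⥤ ModuleCat.{v} R) [G.Additive] {P : C} (x : G.obj P)

lemma yonedaEval_apply {Q : C} (f : P ⟶ Q) : yonedaEval G x Q f = G.map f x := rfl

lemma yonedaEval_comp {Q Q' : C} (f : P ⟶ Q) (g : Q ⟶ Q') :
    yonedaEval G x Q' (f ≫ g) = G.map g (yonedaEval G x Q f) := by
  simp [yonedaEval_apply]

lemma yonedaEval_bijective_of_iso {Q Q' : C} (e : Q ≅ Q')
    (h : Function.Bijective (yonedaEval G x Q)) : Function.Bijective (yonedaEval G x Q') := by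
  have key : (yonedaEval G x Q' : (P ⟶ Q') → G.obj Q') =
      (G.mapIso e).toLinearEquiv ∘ yonedaEval G x Q ∘ (fun f => f ≫ e.inv) := by
    ext f
    change _ = G.map e.hom (yonedaEval G x Q (f ≫ e.inv))
    rw [← yonedaEval_comp]
    simp
  rw [key]
  refine (G.mapIso e).toLinearEquiv.bijective.comp (h.comp ⟨fun f g hfg => ?_, fun f => ?_⟩)
  · exact (cancel_mono e.inv).1 hfg
  · exact ⟨f ≫ e.hom, by simp⟩

/-- Bijectivity passes to objects whose identity is a sum of maps through a given object. -/
lemma yonedaEval_bijective_of_sum {Q A : C} {ι : Type*} (s : Finset ι) (a : ι → (Q ⟶ A))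
    (b : ι → (A ⟶ Q)) (hab : ∑ j ∈ s, a j ≫ b j = 𝟙 Q)
    (h : Function.Bijective (yonedaEval G x A)) : Function.Bijective (yonedaEval G x Q) := by
  constructor
  -- Here `f` is the sum of the `f ≫ a j ≫ b j`, and each `f ≫ a j` is a map to `A` whose evaluation
  -- vanishes.
  · refine (injective_iff_map_eq_zero _).2 fun f hf => ?_
    rw [← Category.comp_id f, ← hab, Preadditive.comp_sum]
    refine Finset.sum_eq_zero fun j _ => ?_
    have : f ≫ a j = 0 := h.1 (by rw [yonedaEval_comp, hf, map_zero, map_zero])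
    rw [← Category.assoc, this, zero_comp]
  · intro y
    -- Each image of `y` in `G(A)` is lifted separately; the lifts are reassembled through the `b
    -- j`.
    choose f hf using fun j => h.2 (G.map (a j) y)
    refine ⟨∑ j ∈ s, f j ≫ b j, ?_⟩
    have hy : y = G.map (∑ j ∈ s, a j ≫ b j) y := by rw [hab]; simp
    conv_rhs => rw [hy]
    change _ = (G.map (∑ j ∈ s, a j ≫ b j)).hom y
    rw [map_sum, Functor.map_sum, ModuleCat.hom_sum, LinearMap.sum_apply]
    refine Finset.sum_congr rfl fun j _ => ?_
    rw [yonedaEval_comp, hf, Functor.map_comp]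
    rfl

variable [HasShift C ℤ]

/-- The objects `Q` such that `Hom(P, Q⟦n⟧) → G(Q⟦n⟧)`, `f ↦ G(f)(x)`, is bijective for all `n`. -/
def evalBijective : ObjectProperty C := fun Q =>
  ∀ n : ℤ, Function.Bijective (yonedaEval G x (Q⟦n⟧))

variable {G x} in
lemma evalBijective.of_iso {Q Q' : C} (e : Q ≅ Q') (h : evalBijective G x Q) :
    evalBijective G x Q' := fun n =>
  yonedaEval_bijective_of_iso G x ((shiftFunctor C n).mapIso e) (h n)

variable {G x} in
lemma evalBijective.shift {Q : C} (h : evalBijective G x Q) (m : ℤ) :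
    evalBijective G x (Q⟦m⟧) := fun n =>
  yonedaEval_bijective_of_iso G x ((shiftFunctorAdd C m n).app Q) (h (m + n))

variable [∀ n : ℤ, (shiftFunctor C n).Additive]

variable {G x} in
lemma evalBijective.of_isZero {Q : C} (h : IsZero Q) : evalBijective G x Q := fun n => by
  have h' : IsZero (Q⟦n⟧) := (shiftFunctor C n).map_isZero h
  have := ModuleCat.subsingleton_of_isZero (G.map_isZero h')
  exact ⟨fun f g _ => h'.eq_of_tgt f g, fun y => ⟨0, Subsingleton.elim _ _⟩⟩

variable [HasZeroObject C] [Pretriangulated C] [G.IsHomological]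

/-- The five lemma, comparing the long exact sequences of `Hom(P, -)` and of `G`. Rotating the
triangle once in each direction supplies the two outer terms. -/
lemma bijective_obj₂_of_distinguished (T : Triangle C) (hT : T ∈ distTriang C)
    (h₀ : Function.Bijective (yonedaEval G x (T.obj₃⟦(-1 : ℤ)⟧)))
    (h₁ : Function.Bijective (yonedaEval G x T.obj₁))
    (h₃ : Function.Bijective (yonedaEval G x T.obj₃))
    (h₄ : Function.Bijective (yonedaEval G x (T.obj₁⟦(1 : ℤ)⟧))) :
    Function.Bijective (yonedaEval G x T.obj₂) := by
  have exF : ∀ S ∈ distTriang C, Function.Exact ((preadditiveCoyoneda.obj (.op P)).map S.mor₁)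
      ((preadditiveCoyoneda.obj (.op P)).map S.mor₂) := fun S hS =>
    (ShortComplex.ab_exact_iff_function_exact _).1
      ((preadditiveCoyoneda.obj (.op P)).map_distinguished_exact S hS)
  have exG : ∀ S ∈ distTriang C, Function.Exact (G.map S.mor₁) (G.map S.mor₂) := fun S hS =>
    (ShortComplex.ShortExact.moduleCat_exact_iff_function_exact _).1
      (G.map_distinguished_exact S hS)
  have comm : ∀ {Q Q' : C} (g : Q ⟶ Q'),
      ((G.map g).hom.toAddMonoidHom).comp (yonedaEval G x Q) =
        (yonedaEval G x Q').comp ((preadditiveCoyoneda.obj (.op P)).map g).hom := by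
    intro Q Q' g
    ext f
    exact (yonedaEval_comp G x f g).symm
  have hi := inv_rot_of_distTriang _ hT
  have hr := rot_of_distTriang _ hT
  exact AddMonoidHom.bijective_of_surjective_of_bijective_of_bijective_of_injective
    ((preadditiveCoyoneda.obj (.op P)).map T.invRotate.mor₁).hom
    ((preadditiveCoyoneda.obj (.op P)).map T.mor₁).hom
    ((preadditiveCoyoneda.obj (.op P)).map T.mor₂).hom
    ((preadditiveCoyoneda.obj (.op P)).map T.mor₃).hom
    (G.map T.invRotate.mor₁).hom.toAddMonoidHom (G.map T.mor₁).hom.toAddMonoidHom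
    (G.map T.mor₂).hom.toAddMonoidHom (G.map T.mor₃).hom.toAddMonoidHom
    _ _ _ _ _ (comm _) (comm _) (comm _) (comm _)
    (exF _ hi) (exF _ hT) (exF _ hr) (exG _ hi) (exG _ hT) (exG _ hr)
    h₀.2 h₁ h₃ h₄.1

variable {G x} in
-- The five lemma at `T.obj₂⟦n⟧` also involves `T.obj₃⟦n⟧⟦-1⟧` and `T.obj₁⟦n⟧⟦1⟧`; this is why
-- `evalBijective` quantifies over all shifts.
lemma evalBijective.ext_of_distinguished (T : Triangle C) (hT : T ∈ distTriang C)
    (h₁ : evalBijective G x T.obj₁) (h₃ : evalBijective G x T.obj₃) :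
    evalBijective G x T.obj₂ := fun n => by
  have z : ∀ {Q : C}, evalBijective G x Q → Function.Bijective (yonedaEval G x Q) := fun h =>
    yonedaEval_bijective_of_iso G x ((shiftFunctorZero C ℤ).app _) (h 0)
  exact bijective_obj₂_of_distinguished G x _ (Triangle.shift_distinguished T hT n)
    ((h₃.shift n) (-1)) (h₁ n) (h₃ n) ((h₁.shift n) 1)

end YonedaEval

/-! ### Dévissage of bounded complexes -/

section Devissage

open Limits Pretriangulated HomologicalComplex

variable {C : Type*} [Category* C] [Abelian C]

/-- The inclusion of the top nonzero term of a complex concentrated in degrees `≤ m`. -/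
def topInclusion (Q : CochainComplex C ℤ) (m : ℤ) (hQ : IsZero (Q.X (m + 1))) :
    (single C (.up ℤ) m).obj (Q.X m) ⟶ Q :=
  mkHomFromSingle (𝟙 (Q.X m)) (by
    intro k hk
    obtain rfl : m + 1 = k := hk
    exact hQ.eq_of_tgt _ _)

variable (Q : CochainComplex C ℤ) (m : ℤ) (hQ : IsZero (Q.X (m + 1)))

instance isIso_topInclusion_f : IsIso ((topInclusion Q m hQ).f m) := by
  have : (topInclusion Q m hQ).f m = (singleObjXSelf (.up ℤ) m (Q.X m)).hom ≫ 𝟙 _ :=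
    mkHomFromSingle_f _ _
  rw [this]
  infer_instance

/-- An isomorphism in degree `m`, and zero source elsewhere. Degreewise splitting is what turns the
short exact sequence into a distinguished triangle of the homotopy category. -/
instance isSplitMono_topInclusion_f (k : ℤ) : IsSplitMono ((topInclusion Q m hQ).f k) := by
  by_cases hk : k = m
  · subst hk
    infer_instance
  · exact ⟨⟨⟨0, (isZero_single_obj_X (.up ℤ) m (Q.X m) k hk).eq_of_src _ _⟩⟩⟩

instance mono_topInclusion : Mono (topInclusion Q m hQ) :=
  mono_of_mono_f _ fun _ => inferInstance

/-- A complex concentrated in degrees `≤ m`, modulo its top term. -/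
def topSequence : ShortComplex (CochainComplex C ℤ) :=
  ShortComplex.mk (topInclusion Q m hQ) (cokernel.π _) (cokernel.condition _)

lemma topSequence_shortExact : (topSequence Q m hQ).ShortExact where
  exact := ShortComplex.exact_cokernel _
  mono_f := mono_topInclusion Q m hQ
  epi_g := ⟨fun _ _ h => coequalizer.hom_ext h⟩

/-- The top term splits off degreewise. -/
def topSequenceSplitting (k : ℤ) :
    ((topSequence Q m hQ).map (eval C (.up ℤ) k)).Splitting :=
  have h := (topSequence_shortExact Q m hQ).map_of_exact (eval C (.up ℤ) k)
  have hf := isSplitMono_topInclusion_f Q m hQ k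
  ShortComplex.Splitting.ofExactOfRetraction _ h.exact
    (@retraction _ _ _ _ ((topInclusion Q m hQ).f k) hf)
    (@IsSplitMono.id _ _ _ _ ((topInclusion Q m hQ).f k) hf) h.epi_g

lemma isZero_topSequence_X₃_X_self : IsZero ((topSequence Q m hQ).X₃.X m) := by
  have h := (topSequence_shortExact Q m hQ).map_of_exact (eval C (.up ℤ) m)
  have : IsIso ((topSequence Q m hQ).map (eval C (.up ℤ) m)).f := isIso_topInclusion_f Q m hQ
  exact h.isIso_f_iff.1 this

/-- Away from degree `m`, nothing changes modulo the top term. -/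
lemma nonempty_topSequence_X₃_X_iso {k : ℤ} (hk : k ≠ m) :
    Nonempty (Q.X k ≅ (topSequence Q m hQ).X₃.X k) := by
  have h := (topSequence_shortExact Q m hQ).map_of_exact (eval C (.up ℤ) k)
  have : IsIso ((topSequence Q m hQ).map (eval C (.up ℤ) k)).g :=
    h.isIso_g_iff.2 (isZero_single_obj_X (.up ℤ) m (Q.X m) k hk)
  exact ⟨@asIso _ _ _ _ _ this⟩

/-- A property of objects of the homotopy category which is stable under extensions holds for
bounded complexes as soon as it holds for their terms, placed in any degree. -/
theorem of_bounded (S : ObjectProperty (HomotopyCategory C (.up ℤ)))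
    (hzero : ∀ X, IsZero X → S X)
    (hext : ∀ T ∈ distTriang (HomotopyCategory C (.up ℤ)), S T.obj₁ → S T.obj₃ → S T.obj₂)
    (A : ObjectProperty C) [A.IsClosedUnderIsomorphisms] (hA : ∀ M, IsZero M → A M)
    (hsingle : ∀ M, A M → ∀ k : ℤ,
      S ((HomotopyCategory.quotient _ _).obj ((CochainComplex.singleFunctor C k).obj M)))
    (n : ℕ) (m : ℤ) (Q : CochainComplex C ℤ) (hle : ∀ k, m < k → IsZero (Q.X k))
    (hge : ∀ k, k ≤ m - n → IsZero (Q.X k)) (hQ : ∀ k, A (Q.X k)) :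
    S ((HomotopyCategory.quotient _ _).obj Q) := by
  -- The nonzero terms lie in the window `m - n < k ≤ m`, of length `n`. Each step removes the term
  -- in degree `m`.
  induction n generalizing m Q with
  | zero =>
    refine hzero _ ((HomotopyCategory.quotient _ _).map_isZero ?_)
    rw [IsZero.iff_id_eq_zero]
    ext k
    refine IsZero.eq_of_src ?_ _ _
    by_cases hk : m < k
    · exact hle k hk
    · exact hge k (by push_cast; omega)
  | succ n ih =>
    have hm := hle (m + 1) (by omega)
    refine hext (CochainComplex.trianglehOfDegreewiseSplit (topSequence Q m hm)
      (topSequenceSplitting Q m hm)) ?_ (hsingle _ (hQ m) m) ?_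
    · exact (HomotopyCategory.distinguished_iff_iso_trianglehOfDegreewiseSplit _).2
        ⟨_, _, ⟨Iso.refl _⟩⟩
    · refine ih (m - 1) (topSequence Q m hm).X₃ ?_ ?_ ?_
      · intro k hk
        by_cases hkm : k = m
        · subst hkm
          exact isZero_topSequence_X₃_X_self Q k hm
        · exact (hle k (by omega)).of_iso (nonempty_topSequence_X₃_X_iso Q m hm hkm).some.symm
      · intro k hk
        by_cases hkm : k = m
        · subst hkm
          exact isZero_topSequence_X₃_X_self Q k hm
        · exact (hge k (by push_cast; omega)).of_iso
            (nonempty_topSequence_X₃_X_iso Q m hm hkm).some.symm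
      · intro k
        by_cases hkm : k = m
        · subst hkm
          exact hA _ (isZero_topSequence_X₃_X_self Q k hm)
        · exact A.prop_of_iso (nonempty_topSequence_X₃_X_iso Q m hm hkm).some (hQ k)

end Devissage

/-! ### Cycles and boundaries in complexes of modules -/

section Cycles

variable {A : Type u} [Ring A] {K L : CochainComplex (ModuleCat.{v} A) ℤ}

lemma exists_cycles_of_d_eq_zero {n : ℤ} (x : K.X n) (hx : K.d n (n + 1) x = 0) :
    ∃ c : K.cycles n, K.iCycles n c = x :=
  ⟨K.cyclesMk x (n + 1) (by simp) hx, K.i_cyclesMk x (n + 1) (by simp) hx⟩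

lemma exists_d_eq_of_homologyπ_eq_zero {n : ℤ} (c : K.cycles n) (hc : K.homologyπ n c = 0)
    (m : ℤ) (hm : m + 1 = n) : ∃ y : K.X m, K.d m n y = K.iCycles n c := by
  have hx : (ShortComplex.mk (K.toCycles m n) (K.homologyπ n) (by simp)).Exact :=
    ShortComplex.exact_of_g_is_cokernel _
      (K.homologyIsCokernel m n (by rw [CochainComplex.prev]; omega))
  obtain ⟨y, hy⟩ := (ShortComplex.moduleCat_exact_iff _).1 hx c hc
  refine ⟨y, ?_⟩
  rw [← K.toCycles_i m n]
  exact congrArg (K.iCycles n) hy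

lemma iCycles_injective (n : ℤ) : Function.Injective (K.iCycles n) :=
  (ModuleCat.mono_iff_injective _).1 inferInstance

lemma homologyπ_surjective (n : ℤ) : Function.Surjective (K.homologyπ n) :=
  (ModuleCat.epi_iff_surjective _).1 inferInstance

lemma homologyMap_homologyπ (g : K ⟶ L) {n : ℤ} (c : K.cycles n) :
    HomologicalComplex.homologyMap g n (K.homologyπ n c) =
      L.homologyπ n (HomologicalComplex.cyclesMap g n c) :=
  congrArg (fun f => f.hom c) (HomologicalComplex.homologyπ_naturality g n)

lemma iCycles_cyclesMap (g : K ⟶ L) {n : ℤ} (c : K.cycles n) :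
    L.iCycles n (HomologicalComplex.cyclesMap g n c) = g.f n (K.iCycles n c) :=
  congrArg (fun f => f.hom c) (HomologicalComplex.cyclesMap_i g n)

/-- A cycle killed by a quasi-isomorphism is a boundary. -/
lemma exists_d_eq_of_quasiIso (g : K ⟶ L) [QuasiIso g] {n : ℤ} (x : K.X n)
    (hx : K.d n (n + 1) x = 0) (hg : g.f n x = 0) (m : ℤ) (hm : m + 1 = n) :
    ∃ y : K.X m, K.d m n y = x := by
  obtain ⟨c, rfl⟩ := exists_cycles_of_d_eq_zero x hx
  refine exists_d_eq_of_homologyπ_eq_zero c ?_ m hm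
  have h0 : HomologicalComplex.cyclesMap g n c = 0 :=
    iCycles_injective n (by rw [iCycles_cyclesMap, hg, map_zero])
  refine (ModuleCat.mono_iff_injective (HomologicalComplex.homologyMap g n)).1 inferInstance ?_
  rw [homologyMap_homologyπ, h0, map_zero, map_zero]

/-- A quasi-isomorphism is surjective on cycles in degrees without boundaries. -/
lemma exists_cycle_of_quasiIso (g : K ⟶ L) [QuasiIso g] {n : ℤ} (w : L.X n)
    (hw : L.d n (n + 1) w = 0) (m : ℤ) (hm : m + 1 = n) (hL : Limits.IsZero (L.X m)) :
    ∃ x : K.X n, (∀ j, K.d n j x = 0) ∧ g.f n x = w := by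
  obtain ⟨cw, rfl⟩ := exists_cycles_of_d_eq_zero w hw
  obtain ⟨y, hy⟩ := (ModuleCat.epi_iff_surjective (HomologicalComplex.homologyMap g n)).1
    inferInstance (L.homologyπ n cw)
  obtain ⟨c, rfl⟩ := homologyπ_surjective n y
  rw [homologyMap_homologyπ] at hy
  -- The image of the lifted cycle agrees with the given one up to a boundary, and the only boundary
  -- is zero because `L.X m` is zero.
  obtain ⟨t, ht⟩ := exists_d_eq_of_homologyπ_eq_zero
    (HomologicalComplex.cyclesMap g n c - cw) (by rw [map_sub, hy, sub_self]) m hm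
  have := ModuleCat.subsingleton_of_isZero hL
  rw [Subsingleton.elim t 0, map_zero, map_sub, iCycles_cyclesMap] at ht
  exact ⟨K.iCycles n c, fun j => congrArg (fun f => f.hom c) (K.iCycles_d n j),
    (sub_eq_zero.1 ht.symm)⟩

end Cycles

/-! ### Maps to a complex concentrated in one degree -/

section Single

open CochainComplex.HomComplex

variable {C : Type*} [Category* C] [Abelian C]

/-- A map to a complex concentrated in degree `k` is null-homotopic if its component in degree `k`
factors through the differential. -/
lemma quotient_map_eq_zero_of_factors {K : CochainComplex C ℤ} {k : ℤ} {A : C}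
    (f : K ⟶ (CochainComplex.singleFunctor C k).obj A) {m : ℤ} (hm : m + (-1) = k)
    (ψ : K.X m ⟶ A)
    (hψ : f.f k ≫ (HomologicalComplex.singleObjXSelf (.up ℤ) k A).hom = K.d k m ≫ ψ) :
    (HomotopyCategory.quotient C (.up ℤ)).map f = 0 := by
  rw [← Functor.map_zero]
  -- The homotopy is `ψ` itself, a cochain of degree `-1`; the sign in its coboundary is `(-1)^0`.
  refine HomotopyCategory.eq_of_homotopy _ _ ((Cochain.equivHomotopy _ _).symm
    ⟨Cochain.toSingleMk ψ hm, ?_⟩)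
  rw [Cochain.δ_toSingleMk ψ hm 0 k (by omega), Cochain.ofHom_zero, add_zero,
    Int.negOnePow_zero, one_smul]
  apply (Cochain.toSingleEquiv (p := k) (add_zero k)).injective
  rw [Cochain.toSingleEquiv_toSingleMk, ← hψ]
  change (Cochain.ofHom f).v k k (add_zero k) ≫ _ = _
  rw [Cochain.ofHom_v]

end Single

/-! ### The free module of rank one -/

section Free

attribute [local instance] baseModule baseModule_tower

variable (R : Type u) [CommRing R] (B : Type v) [Ring B] [Algebra R B]

/-- `Bᵉ` as a module over itself. -/
def envModule : ModuleCat.{v} (Env R B) := ModuleCat.of (Env R B) (Env R B)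

/-- The identity of `Bᵉ`, as an element of its dual. -/
def idDual : Dual R B (envModule R B) := (LinearMap.id : Env R B →ₗ[Env R B] Env R B)

variable {R B}

/-- This is the injective half of `Bᵉ ⊗ B ≅ B`: the map `b ↦ 1 ⊗ b` is a left inverse. -/
lemma evalAt_idDual_injective :
    Function.Injective (evalAt (R := R) (B := B) (M := envModule R B) (idDual R B)) := by
  have key : ∀ t : TensorDiag R B (envModule R B),
      tmk R B (M := envModule R B) (1 : Env R B) (evalAt (idDual R B) t) = t := by
    intro t
    induction t using TensorDiag.induction with
    | h0 => rw [map_zero]; exact congrArg Submodule.Quotient.mk (TensorProduct.tmul_zero _ _)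
    | ht m b =>
      -- Write `m` as `envSwap (envSwap m) * 1`, so that `envSwap m` moves across the tensor sign.
      refine (tmk_smul (M := envModule R B) (1 : Env R B) _ b).symm.trans
        (congrArg (tmk R B (M := envModule R B) · b) ?_)
      exact (mul_one (envSwap R B (envSwap R B (m : Env R B)))).trans (envSwap_envSwap R B m)
    | ha x y hx hy =>
      rw [map_add]
      conv_rhs => rw [← hx, ← hy]
      exact congrArg Submodule.Quotient.mk (TensorProduct.tmul_add _ _ _)
  intro s t h
  rw [← key s, h, key t]

/-- The link between `η⁺` and the Yoneda map: evaluation at `φ` is `φ ⊗ B` followed by the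
identification `Bᵉ ⊗ B ≅ B`. -/
lemma evalAt_idDual_map {M : ModuleCat.{v} (Env R B)} (φ : M ⟶ envModule R B)
    (z : TensorDiag R B M) :
    evalAt (idDual R B) (TensorDiag.map φ.hom z) = evalAt (M := M) (φ.hom : Dual R B M) z := by
  induction z using TensorDiag.induction with
  | h0 => simp
  | ht m b => rfl
  | ha x y hx hy => rw [map_add, map_add, hx, hy, map_add]

end Free

/-! ### Nondegenerate classes and free modules -/

section Base

attribute [local instance] baseModule baseModule_tower

variable (R : Type u) [CommRing R] (B : Type v) [Ring B] [Algebra R B]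

/-- The homological functor `K ↦ H^{-d}(K ⊗_{Bᵉ} B)` on the homotopy category. -/
def tensorHomology (d : ℤ) :
    HomotopyCategory (ModuleCat.{v} (Env R B)) (.up ℤ) ⥤ ModuleCat.{v} R :=
  (tensorDiag R B).mapHomotopyCategory (.up ℤ) ⋙
    HomotopyCategory.homologyFunctor (ModuleCat.{v} R) (.up ℤ) (-d)

instance (d : ℤ) : (tensorHomology R B d).Additive := by
  dsimp only [tensorHomology]
  infer_instance

instance (d : ℤ) : (tensorHomology R B d).IsHomological := by
  dsimp only [tensorHomology]
  infer_instance

/-- The value of `tensorHomology` on a complex `K` is the homology of `K ⊗_{Bᵉ} B`. -/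
def tensorHomologyIso (d : ℤ) :
    HomotopyCategory.quotient (ModuleCat.{v} (Env R B)) (.up ℤ) ⋙ tensorHomology R B d ≅
      (tensorDiag R B).mapHomologicalComplex (.up ℤ) ⋙
        HomologicalComplex.homologyFunctor (ModuleCat.{v} R) (.up ℤ) (-d) :=
  Functor.isoWhiskerRight ((tensorDiag R B).mapHomotopyCategoryFactors (.up ℤ)) _ ≪≫
    Functor.isoWhiskerLeft ((tensorDiag R B).mapHomologicalComplex (.up ℤ))
      (HomotopyCategory.homologyFunctorFactors (ModuleCat.{v} R) (.up ℤ) (-d))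

variable {R B}

/-- A class in `HH_d(B)`, as an element of the value of `tensorHomology` at the resolution. -/
def resClass {d : ℤ} (η : HHlower R B d) :
    (tensorHomology R B d).obj ((HomotopyCategory.quotient _ _).obj (res R B)) :=
  (tensorHomologyIso R B d).inv.app (res R B) η

lemma yonedaEval_resClass {d : ℤ} (η : HHlower R B d)
    {L : CochainComplex (ModuleCat.{v} (Env R B)) ℤ} (f : res R B ⟶ L) :
    yonedaEval (tensorHomology R B d) (resClass η) _ ((HomotopyCategory.quotient _ _).map f) =
      (tensorHomologyIso R B d).inv.app L (HomologicalComplex.homologyMap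
        (((tensorDiag R B).mapHomologicalComplex (.up ℤ)).map f) (-d) η) :=
  congrArg (fun g => g.hom η) ((tensorHomologyIso R B d).inv.naturality f).symm

/-! ### Cohomology of the dual complex under `η⁺` -/

section Dual

variable {d : ℤ} (z : (tensorComplex R B).cycles (-d))

lemma evalChain_f_self (φ : Dual R B ((res R B).X (-d))) :
    (evalChain (res R B) d (cycleElt z) (cycleElt_d z)).f d
      (φ : (dualComplex (res R B)).X d) =
      (HomologicalComplex.singleObjXSelf (.up ℤ) d (diag R B)).inv (evalAt φ (cycleElt z)) := by
  have e : (evalChain (res R B) d (cycleElt z) (cycleElt_d z)).f d = _ :=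
    HomologicalComplex.mkHomToSingle_f _ _
  exact congrArg (fun f => f.hom φ) e

/-- The target is zero outside degree `d`, so the condition on `φ` is imposed only when `n = d`;
this form treats all degrees at once. -/
lemma evalChain_f_eq_zero (n : ℤ) (φ : Dual R B ((res R B).X (-n)))
    (h : ∀ hn : n = d, evalAt (hn ▸ φ : Dual R B ((res R B).X (-d))) (cycleElt z) = 0) :
    (evalChain (res R B) d (cycleElt z) (cycleElt_d z)).f n
      (φ : (dualComplex (res R B)).X n) = 0 := by
  by_cases hn : n = d
  · subst hn
    rw [evalChain_f_self z]
    exact (congrArg _ (h rfl)).trans (map_zero _)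
  · have := ModuleCat.subsingleton_of_isZero
      (HomologicalComplex.isZero_single_obj_X (.up ℤ) d (diag R B) n hn)
    exact Subsingleton.elim (α := ((HomologicalComplex.single _ (.up ℤ) d).obj (diag R B)).X n) _ _

variable [QuasiIso (evalChain (res R B) d (cycleElt z) (cycleElt_d z))]

/-- A cycle of the dual complex on which `η⁺` vanishes is a boundary. -/
lemma exists_dual_boundary {n : ℤ} (φ : (res R B).X (-n) ⟶ envModule R B)
    (hφ : (res R B).d (-(n + 1)) (-n) ≫ φ = 0)
    (h : ∀ hn : n = d, evalAt (hn ▸ (φ.hom : Dual R B ((res R B).X (-n))) :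
      Dual R B ((res R B).X (-d))) (cycleElt z) = 0) :
    ∃ ψ : (res R B).X (-(n - 1)) ⟶ envModule R B,
      (res R B).d (-n) (-(n - 1)) ≫ ψ = φ := by
  obtain ⟨ψ, hψ⟩ := exists_d_eq_of_quasiIso
    (evalChain (res R B) d (cycleElt z) (cycleElt_d z)) (n := n)
    (φ.hom : Dual R B ((res R B).X (-n))) (congrArg ModuleCat.Hom.hom hφ)
    (evalChain_f_eq_zero z n _ h) (n - 1) (by omega)
  exact ⟨ModuleCat.ofHom ψ, ModuleCat.hom_ext hψ⟩

/-- Every element of `B` is the value of `η⁺` on a cycle of the dual complex. -/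
lemma exists_dual_cycle (b : B) :
    ∃ φ : (res R B).X (-d) ⟶ envModule R B,
      (∀ j, (res R B).d j (-d) ≫ φ = 0) ∧
        evalAt (φ.hom : Dual R B ((res R B).X (-d))) (cycleElt z) = b := by
  obtain ⟨φ, hφ, h⟩ := exists_cycle_of_quasiIso
    (evalChain (res R B) d (cycleElt z) (cycleElt_d z)) (n := d)
    ((HomologicalComplex.singleObjXSelf (.up ℤ) d (diag R B)).inv b)
    (by
      have := ModuleCat.subsingleton_of_isZero
        (HomologicalComplex.isZero_single_obj_X (.up ℤ) d (diag R B) (d + 1) (by omega))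
      exact Subsingleton.elim
        (α := ((HomologicalComplex.single _ (.up ℤ) d).obj (diag R B)).X (d + 1)) _ _)
    (d - 1) (by omega)
    (HomologicalComplex.isZero_single_obj_X (.up ℤ) d (diag R B) (d - 1) (by omega))
  refine ⟨ModuleCat.ofHom (φ : Dual R B ((res R B).X (-d))), fun j => ?_, ?_⟩
  -- The dual complex is indexed by negated degrees, hence the rewriting of `j`.
  · obtain ⟨j, rfl⟩ : ∃ k, j = -k := ⟨-j, (neg_neg j).symm⟩
    exact ModuleCat.hom_ext (hφ j)
  · exact (ModuleCat.mono_iff_injective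
      (HomologicalComplex.singleObjXSelf (.up ℤ) d (diag R B)).inv).1 inferInstance
      ((evalChain_f_self z φ).symm.trans h)

end Dual

/-- Localization detects quasi-isomorphisms, so nondegeneracy becomes a statement about complexes
and can be used on elements. -/
lemma quasiIso_evalChain [HasDerivedCategory.{w} (ModuleCat.{v} (Env R B))] {d : ℤ}
    {z : (tensorComplex R B).cycles (-d)}
    (h : Nondegenerate (d := d) ((tensorComplex R B).homologyπ (-d) z)) :
    QuasiIso (evalChain (res R B) d (cycleElt z) (cycleElt_d z)) := by
  have h' : IsIso (cycleToD z) := by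
    rw [← toDual_homologyπ]
    exact h
  rw [← DerivedCategory.isIso_Q_map_iff_quasiIso]
  exact (isIso_comp_right_iff _
    ((DerivedCategory.singleFunctorIsoCompQ _ d).app (diag R B)).inv).1 h'

end Base

/-! ### The Yoneda map at shifts of `Bᵉ` -/

section FreeTarget

attribute [local instance] baseModule baseModule_tower

variable (R : Type u) [CommRing R] (B : Type v) [Ring B] [Algebra R B]

/-- The complex `Bᵉ[-k]`. -/
def envSingle (k : ℤ) : CochainComplex (ModuleCat.{v} (Env R B)) ℤ :=
  (CochainComplex.singleFunctor _ k).obj (envModule R B)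

/-- The term of `Bᵉ[-k]` in degree `k`. -/
def envSingleXIso (k : ℤ) : (envSingle R B k).X k ≅ envModule R B :=
  HomologicalComplex.singleObjXSelf (.up ℤ) k (envModule R B)

variable {R B}

lemma isZero_envSingle_X {k j : ℤ} (h : j ≠ k) : Limits.IsZero ((envSingle R B k).X j) :=
  HomologicalComplex.isZero_single_obj_X (.up ℤ) k (envModule R B) j h

/-- The component of a map `P → Bᵉ[-k]` in degree `k`. -/
def envComponent {k : ℤ} (f : res R B ⟶ envSingle R B k) : (res R B).X k ⟶ envModule R B :=
  f.f k ≫ (envSingleXIso R B k).hom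

lemma d_comp_envComponent {k : ℤ} (f : res R B ⟶ envSingle R B k) {j : ℤ} (hj : j ≠ k) :
    (res R B).d j k ≫ envComponent f = 0 := by
  rw [envComponent, ← Category.assoc, ← f.comm, (isZero_envSingle_X hj).eq_of_tgt (f.f j) 0,
    Limits.zero_comp, Limits.zero_comp]

lemma exists_envComponent_eq {k : ℤ} (φ : (res R B).X k ⟶ envModule R B)
    (hφ : ∀ j, (res R B).d j k ≫ φ = 0) :
    ∃ f : res R B ⟶ envSingle R B k, envComponent f = φ := by
  refine ⟨HomologicalComplex.mkHomToSingle φ fun j _ => hφ j, ?_⟩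
  have e : envComponent (HomologicalComplex.mkHomToSingle φ fun j _ => hφ j) =
      (φ ≫ (envSingleXIso R B k).inv) ≫ (envSingleXIso R B k).hom :=
    congrArg (· ≫ _) (HomologicalComplex.mkHomToSingle_f _ _)
  rw [e, Category.assoc, Iso.inv_hom_id, Category.comp_id]

variable (R B) in
/-- The functor `K ↦ K ⊗_{Bᵉ} B` on complexes. -/
abbrev tensorFunctor :
    CochainComplex (ModuleCat.{v} (Env R B)) ℤ ⥤ CochainComplex (ModuleCat.{v} R) ℤ :=
  (tensorDiag R B).mapHomologicalComplex (.up ℤ)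

lemma isZero_tensorFunctor_envSingle_X {k j : ℤ} (h : j ≠ k) :
    Limits.IsZero (((tensorFunctor R B).obj (envSingle R B k)).X j) :=
  (tensorDiag R B).map_isZero (isZero_envSingle_X h)

/-- The element of `B` corresponding to a cycle in `Bᵉ[-k] ⊗_{Bᵉ} B`. -/
def envValue {k : ℤ} (c : ((tensorFunctor R B).obj (envSingle R B k)).cycles k) : B :=
  evalAt (idDual R B) (TensorDiag.map (envSingleXIso R B k).hom.hom
    (((tensorFunctor R B).obj (envSingle R B k)).iCycles k c))

lemma envValue_zero {k : ℤ} :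
    envValue (0 : ((tensorFunctor R B).obj (envSingle R B k)).cycles k) = 0 := by
  rw [envValue, map_zero]
  exact (congrArg _ (map_zero (TensorDiag.map _))).trans (map_zero _)

lemma tensorDiag_map_injective_of_iso {M N : ModuleCat.{v} (Env R B)} (e : M ≅ N) :
    Function.Injective (TensorDiag.map (R := R) (B := B) e.hom.hom) :=
  (ModuleCat.mono_iff_injective ((tensorDiag R B).map e.hom)).1 inferInstance

lemma envValue_injective (k : ℤ) : Function.Injective
    (envValue : ((tensorFunctor R B).obj (envSingle R B k)).cycles k → B) := fun _ _ h =>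
  iCycles_injective k (tensorDiag_map_injective_of_iso _ (evalAt_idDual_injective h))

/-- Boundaries in degree `k` come from degree `k - 1`, where the complex is zero. -/
lemma homologyπ_envSingle_injective (k : ℤ) :
    Function.Injective (((tensorFunctor R B).obj (envSingle R B k)).homologyπ k) := by
  refine (injective_iff_map_eq_zero _).2 fun c hc => iCycles_injective k ?_
  obtain ⟨y, hy⟩ := exists_d_eq_of_homologyπ_eq_zero c hc (k - 1) (by omega)
  have := ModuleCat.subsingleton_of_isZero
    (isZero_tensorFunctor_envSingle_X (R := R) (B := B) (k := k) (j := k - 1) (by omega))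
  rw [← hy, Subsingleton.elim y 0, map_zero, map_zero]

lemma envValue_cyclesMap {d : ℤ} (z : (tensorComplex R B).cycles (-d))
    (f : res R B ⟶ envSingle R B (-d)) :
    envValue (HomologicalComplex.cyclesMap ((tensorFunctor R B).map f) (-d) z) =
      evalAt ((envComponent f).hom : Dual R B ((res R B).X (-d))) (cycleElt z) := by
  rw [← evalAt_idDual_map, envValue, envComponent, ModuleCat.hom_comp, TensorDiag.map_comp]
  exact congrArg (fun t => evalAt (idDual R B) (TensorDiag.map (envSingleXIso R B (-d)).hom.hom t))
    (iCycles_cyclesMap ((tensorFunctor R B).map f) z)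

/-- The map induced by `P → Bᵉ[d]` on the class of a cycle, in terms of underlying elements. -/
lemma homologyMap_envSingle_eq_iff {d : ℤ} (z : (tensorComplex R B).cycles (-d))
    (f : res R B ⟶ envSingle R B (-d))
    (c : ((tensorFunctor R B).obj (envSingle R B (-d))).cycles (-d)) :
    HomologicalComplex.homologyMap ((tensorFunctor R B).map f) (-d)
        ((tensorComplex R B).homologyπ (-d) z) =
      ((tensorFunctor R B).obj (envSingle R B (-d))).homologyπ (-d) c ↔
      evalAt ((envComponent f).hom : Dual R B ((res R B).X (-d))) (cycleElt z) = envValue c := by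
  rw [← envValue_cyclesMap, (envValue_injective (-d)).eq_iff,
    ← (homologyπ_envSingle_injective (-d)).eq_iff]
  exact Eq.congr_left (homologyMap_homologyπ ((tensorFunctor R B).map f) z)

/-- With `k = -n`, a map `P → Bᵉ[n]` is an `n`-cocycle of the dual complex, null-homotopic when it
is a coboundary. Evaluation at `η` is then the action of `η⁺` on cohomology in degree `n`. -/
lemma bijective_envSingle [HasDerivedCategory.{w} (ModuleCat.{v} (Env R B))]
    {d : ℤ} {η : HHlower R B d} (h : Nondegenerate η) (k : ℤ) :
    Function.Bijective (yonedaEval (tensorHomology R B d) (resClass η)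
      ((HomotopyCategory.quotient _ _).obj (envSingle R B k))) := by
  obtain ⟨z, rfl⟩ := exists_cycle η
  have := quasiIso_evalChain h
  have inv_inj : Function.Injective ((tensorHomologyIso R B d).inv.app (envSingle R B k)) :=
    (ModuleCat.mono_iff_injective _).1 inferInstance
  have inv_surj : Function.Surjective ((tensorHomologyIso R B d).inv.app (envSingle R B k)) :=
    (ModuleCat.epi_iff_surjective _).1 inferInstance
  obtain ⟨n, rfl⟩ : ∃ n, k = -n := ⟨-k, (neg_neg k).symm⟩
  constructor
  · refine (injective_iff_map_eq_zero _).2 fun f' hf => ?_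
    obtain ⟨f, rfl⟩ := (HomotopyCategory.quotient _ _).map_surjective f'
    rw [yonedaEval_resClass] at hf
    have hf := inv_inj (hf.trans (map_zero _).symm)
    -- For `n ≠ d` the vanishing condition is vacuous; for `n = d` it is `hf` read in `B`.
    obtain ⟨ψ, hψ⟩ := exists_dual_boundary z (envComponent f)
      (d_comp_envComponent f (by omega)) (by
        rintro rfl
        have hf' := (homologyMap_envSingle_eq_iff z f 0).1 (hf.trans (map_zero _).symm)
        exact hf'.trans envValue_zero)
    exact quotient_map_eq_zero_of_factors f (by omega) ψ hψ.symm
  · intro y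
    obtain ⟨y, rfl⟩ := inv_surj y
    by_cases hn : n = d
    · subst hn
      obtain ⟨c, rfl⟩ := homologyπ_surjective _ y
      obtain ⟨φ, hφ, e⟩ := exists_dual_cycle z (envValue c)
      obtain ⟨f, rfl⟩ := exists_envComponent_eq φ hφ
      refine ⟨(HomotopyCategory.quotient _ _).map f, ?_⟩
      rw [yonedaEval_resClass]
      exact congrArg _ ((homologyMap_envSingle_eq_iff z f c).2 e)
    · have h1 : Limits.IsZero (((tensorFunctor R B).obj (envSingle R B (-n))).homology (-d)) :=
        ShortComplex.isZero_homology_of_isZero_X₂ _ (isZero_tensorFunctor_envSingle_X (by omega))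
      have := ModuleCat.subsingleton_of_isZero h1
      refine ⟨0, ?_⟩
      rw [map_zero]
      exact (map_zero _).symm.trans (congrArg _ (Subsingleton.elim
        (α := ((tensorFunctor R B).obj (envSingle R B (-n))).homology (-d)) _ _))

end FreeTarget

/-! ### Poincaré duality -/

section Duality

attribute [local instance] baseModule baseModule_tower

variable (R : Type u) [CommRing R] (B : Type v) [Ring B] [Algebra R B]

/-- The modules whose identity is a finite sum of maps factoring through `Bᵉ`. -/
def factorsThroughEnv : ObjectProperty (ModuleCat.{v} (Env R B)) := fun M =>
  ∃ (n : ℕ) (a : Fin n → (M ⟶ envModule R B)) (b : Fin n → (envModule R B ⟶ M)),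
    ∑ j, a j ≫ b j = 𝟙 M

variable {R B}

instance : (factorsThroughEnv R B).IsClosedUnderIsomorphisms where
  of_iso {M N} e h := by
    obtain ⟨n, a, b, hab⟩ := h
    refine ⟨n, fun j => e.inv ≫ a j, fun j => b j ≫ e.hom, ?_⟩
    have : ∑ j, (e.inv ≫ a j) ≫ b j ≫ e.hom = e.inv ≫ (∑ j, a j ≫ b j) ≫ e.hom := by
      simp [Preadditive.comp_sum, Preadditive.sum_comp]
    rw [this, hab, Category.id_comp, Iso.inv_hom_id]

lemma factorsThroughEnv_of_isZero {M : ModuleCat.{v} (Env R B)} (h : Limits.IsZero M) :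
    factorsThroughEnv R B M :=
  ⟨0, fun _ => 0, fun _ => 0, h.eq_of_src _ _⟩

/-- Such a module is a retract of a finite free one; the coordinates of the section and of the
retraction give the two families of maps. -/
lemma factorsThroughEnv_of_projective {M : ModuleCat.{v} (Env R B)} [Module.Finite (Env R B) M]
    [Projective M] : factorsThroughEnv R B M := by
  have : Module.Projective (Env R B) M := (IsProjective.iff_projective M).2 inferInstance
  obtain ⟨n, f, g, -, -, hfg⟩ := Module.Finite.exists_comp_eq_id_of_projective (Env R B) M
  refine ⟨n, fun j => ModuleCat.ofHom ((LinearMap.proj j).comp g),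
    fun j => ModuleCat.ofHom (f.comp (LinearMap.single (Env R B) (fun _ => Env R B) j)), ?_⟩
  refine ModuleCat.hom_ext (LinearMap.ext fun m => ?_)
  rw [ModuleCat.hom_sum, LinearMap.sum_apply]
  change ∑ j, f (Pi.single j (g m j)) = m
  rw [← map_sum, Finset.univ_sum_single]
  exact LinearMap.congr_fun hfg m

variable [HasDerivedCategory.{w} (ModuleCat.{v} (Env R B))]

lemma evalBijective_single {d : ℤ} {η : HHlower R B d} (h : Nondegenerate η)
    {M : ModuleCat.{v} (Env R B)} (hM : factorsThroughEnv R B M) (k : ℤ) :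
    evalBijective (tensorHomology R B d) (resClass η)
      ((HomotopyCategory.quotient _ _).obj ((CochainComplex.singleFunctor _ k).obj M)) := by
  intro n
  obtain ⟨N, a, b, hab⟩ := hM
  -- Shifting by `n` moves an object in degree `k` to degree `k - n`.
  let F := HomotopyCategory.singleFunctor (ModuleCat.{v} (Env R B)) (k - n)
  have key : Function.Bijective
      (yonedaEval (tensorHomology R B d) (resClass η) (F.obj M)) := by
    refine yonedaEval_bijective_of_sum _ _ Finset.univ (fun j => F.map (a j))
      (fun j => F.map (b j)) ?_ (bijective_envSingle h (k - n))
    simp only [← F.map_comp, ← F.map_sum, hab, F.map_id]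
  exact yonedaEval_bijective_of_iso _ _
    (((HomotopyCategory.singleFunctors _).shiftIso n (k - n) k (by omega)).app M).symm key

/-- Two projective resolutions of `B` are isomorphic in the homotopy category. -/
lemma nonempty_quotient_res_iso (P : ProjectiveResolution (diag R B)) :
    Nonempty ((HomotopyCategory.quotient _ (.up ℤ)).obj P.cochainComplex ≅
      (HomotopyCategory.quotient _ (.up ℤ)).obj (res R B)) := by
  let Z := (HomotopyCategory.quotient (ModuleCat.{v} (Env R B)) (.up ℤ))
  have e : DerivedCategory.Qh.obj (Z.obj P.cochainComplex) ≅
      DerivedCategory.Qh.obj (Z.obj (res R B)) :=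
    (DerivedCategory.quotientCompQhIso _).app _ ≪≫ asIso (DerivedCategory.Q.map P.π') ≪≫
      (asIso (DerivedCategory.Q.map (resAug R B))).symm ≪≫
      ((DerivedCategory.quotientCompQhIso _).app _).symm
  -- Both complexes are K-projective, so the isomorphism in the derived category and its inverse
  -- lift to the homotopy category, where the two composites are identities by injectivity.
  have hP := CochainComplex.IsKProjective.Qh_map_bijective P.cochainComplex
  have hR := CochainComplex.IsKProjective.Qh_map_bijective (res R B)
  obtain ⟨f, hf⟩ := (hP (Z.obj (res R B))).2 e.hom
  obtain ⟨g, hg⟩ := (hR (Z.obj P.cochainComplex)).2 e.inv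
  refine ⟨⟨f, g, (hP _).1 ?_, (hR _).1 ?_⟩⟩
  · rw [Functor.map_comp, hf, hg, Iso.hom_inv_id, CategoryTheory.Functor.map_id]
  · rw [Functor.map_comp, hf, hg, Iso.inv_hom_id, CategoryTheory.Functor.map_id]

/-- The chosen resolution need not be finite. Smoothness provides one that is bounded with finitely
generated terms, and the property is invariant under homotopy equivalence. -/
lemma evalBijective_res {d : ℤ} {η : HHlower R B d} (h : IsCalabiYau η) :
    evalBijective (tensorHomology R B d) (resClass η)
      ((HomotopyCategory.quotient _ _).obj (res R B)) := by
  obtain ⟨-, P, hfin, N, hN⟩ := h.smooth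
  refine evalBijective.of_iso (nonempty_quotient_res_iso P).some ?_
  -- The terms of `P` lie in degrees `-N, …, 0`, a window of `N + 1` degrees ending at `0`.
  refine of_bounded (evalBijective (tensorHomology R B d) (resClass η))
    (fun _ hX => evalBijective.of_isZero hX)
    (fun T hT h₁ h₃ => evalBijective.ext_of_distinguished T hT h₁ h₃)
    (factorsThroughEnv R B) (fun _ hM => factorsThroughEnv_of_isZero hM)
    (fun M hM k => evalBijective_single h.nondegenerate hM k) (N + 1) 0 P.cochainComplex ?_ ?_ ?_
  · intro k hk
    exact CochainComplex.isZero_of_isStrictlyLE _ 0 _ hk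
  · intro k hk
    obtain ⟨j, rfl⟩ : ∃ j : ℕ, k = -j := ⟨(-k).toNat, by omega⟩
    exact (hN j (by omega)).of_iso (P.cochainComplexXIso (-j) j)
  · intro k
    by_cases hk : 0 < k
    · exact factorsThroughEnv_of_isZero (CochainComplex.isZero_of_isStrictlyLE _ 0 _ hk)
    · obtain ⟨j, rfl⟩ : ∃ j : ℕ, k = -j := ⟨(-k).toNat, by omega⟩
      have := hfin j
      exact (factorsThroughEnv R B).prop_of_iso (P.cochainComplexXIso (-j) j).symm
        factorsThroughEnv_of_projective

end Duality

/-! ### The cap product as a Yoneda map, and vanishing in negative degrees -/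

section Cap

attribute [local instance] baseModule baseModule_tower

variable {R : Type u} [CommRing R] {B : Type v} [Ring B] [Algebra R B]

lemma TensorDiag.map_smul {M N : ModuleCat.{v} (Env R B)} (r : R) (f : M →ₗ[Env R B] N) :
    TensorDiag.map (r • f) = r • TensorDiag.map f := by
  refine LinearMap.ext fun x => ?_
  induction x using TensorDiag.induction with
  | h0 => rw [map_zero, map_zero]
  | ht m b => rfl
  | ha x y hx hy => rw [_root_.map_add, _root_.map_add, hx, hy]

instance : (tensorDiag R B).Linear R where
  map_smul f r := ModuleCat.hom_ext (TensorDiag.map_smul r f.hom)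

variable (R B) in
/-- The identification of `H^{-d}` of `Σ^i P ⊗_{Bᵉ} B` with `HH_{d-i}(B)`. -/
def homologyShiftIso (i d : ℤ) :
    ((tensorFunctor R B).obj ((res R B)⟦i⟧)).homology (-d) ≅ HHlower R B (d - i) :=
  (HomologicalComplex.homologyFunctor (ModuleCat.{v} R) (.up ℤ) (-d)).mapIso
      (((tensorFunctor R B).commShiftIso i).app (res R B)) ≪≫
    ((HomologicalComplex.homologyFunctor (ModuleCat.{v} R) (.up ℤ) 0).shiftIso i (-d) (-(d - i))
      (by ring)).app ((tensorFunctor R B).obj (res R B))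

/-- Isolates the dependence on `f` in the first factor; the second is a fixed isomorphism, so
linearity and bijectivity can be checked on the first. -/
lemma capChain_eq_comp {i : ℤ} (f : ShiftedHom (res R B) (res R B) i) (d : ℤ) :
    capChain f d = HomologicalComplex.homologyMap ((tensorFunctor R B).map f) (-d) ≫
      (homologyShiftIso R B i d).hom := by
  change (HomologicalComplex.homologyFunctor (ModuleCat.{v} R) (.up ℤ) (-d)).map
    ((tensorFunctor R B).map f ≫ _) ≫ _ = _
  rw [Functor.map_comp]
  exact Category.assoc _ _ _

lemma capChain_add {i : ℤ} (f g : ShiftedHom (res R B) (res R B) i) (d : ℤ) :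
    capChain (f + g) d = capChain f d + capChain g d := by
  simp only [capChain_eq_comp, Functor.map_add, HomologicalComplex.homologyMap_add,
    Preadditive.add_comp]
  rfl

lemma homologyMap_smul {K L : CochainComplex (ModuleCat.{v} R) ℤ} (r : R) (g : K ⟶ L) (n : ℤ) :
    HomologicalComplex.homologyMap (r • g) n = r • HomologicalComplex.homologyMap g n :=
  ShortComplex.homologyMap_smul ((HomologicalComplex.shortComplexFunctor _ _ n).map g) r

lemma capChain_smul {i : ℤ} (r : R) (f : ShiftedHom (res R B) (res R B) i) (d : ℤ) :
    capChain (r • f) d = r • capChain f d := by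
  simp only [capChain_eq_comp, Functor.map_smul, homologyMap_smul, Linear.smul_comp]
  rfl

/-- The resolution has no terms in positive cohomological degree `-i`. -/
lemma subsingleton_HHlower_of_neg {i : ℤ} (hi : i < 0) : Subsingleton (HHlower R B i) := by
  have h0 : Limits.IsZero ((res R B).X (-i)) :=
    CochainComplex.isZero_of_isStrictlyLE (projectiveResolution (diag R B)).cochainComplex 0 _
      (by omega)
  exact ModuleCat.subsingleton_of_isZero
    (ShortComplex.isZero_homology_of_isZero_X₂ _ ((tensorDiag R B).map_isZero h0))

variable [HasDerivedCategory.{w} (ModuleCat.{v} (Env R B))]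

lemma Represents.add {i : ℤ} {f g : ShiftedHom (res R B) (res R B) i} {μ ν : HHupper R B i}
    (hf : Represents f μ) (hg : Represents g ν) : Represents (f + g) (μ + ν) := by
  simp only [Represents, ShiftedHom.map, Functor.map_add, Preadditive.add_comp,
    Preadditive.comp_add] at hf hg ⊢
  rw [hf, hg]

lemma Represents.smul {i : ℤ} (r : R) {f : ShiftedHom (res R B) (res R B) i} {μ : HHupper R B i}
    (hf : Represents f μ) : Represents (r • f) (r • μ) := by
  simp only [Represents, ShiftedHom.map, Functor.map_smul, Linear.smul_comp,
    Linear.comp_smul] at hf ⊢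
  rw [hf]

lemma exists_represented {i : ℤ} (f : ShiftedHom (res R B) (res R B) i) :
    ∃ μ : HHupper R B i, Represents f μ :=
  ⟨(resIso R B).inv ≫ f.map DerivedCategory.Q ≫ (resIso R B).hom⟦i⟧', by
    simp [Represents]⟩

/-- The cap product with a class in `HH_d(B)`, as an `R`-linear map. -/
def capLinear {d : ℤ} (η : HHlower R B d) (i : ℤ) :
    HHupper R B i →ₗ[R] HHlower R B (d - i) where
  toFun μ := cap μ η
  map_add' μ ν := by
    obtain ⟨f, hf⟩ := exists_represents μ
    obtain ⟨g, hg⟩ := exists_represents ν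
    rw [cap_eq hf, cap_eq hg, cap_eq (hf.add hg), capChain_add]
    rfl
  map_smul' r μ := by
    obtain ⟨f, hf⟩ := exists_represents μ
    rw [cap_eq hf, cap_eq (hf.smul r), capChain_smul]
    rfl

lemma capLinear_bijective {d : ℤ} {η : HHlower R B d} (h : IsCalabiYau η) (i : ℤ) :
    Function.Bijective (capLinear η i) := by
  let Z := HomotopyCategory.quotient (ModuleCat.{v} (Env R B)) (.up ℤ)
  have hb : Function.Bijective
      (yonedaEval (tensorHomology R B d) (resClass η) (Z.obj ((res R B)⟦i⟧))) :=
    yonedaEval_bijective_of_iso _ _ ((Z.commShiftIso i).app (res R B)).symm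
      (evalBijective_res h i)
  -- On representatives, the cap product is the Yoneda map at `Σ^i P` followed by two isomorphisms.
  have key : ∀ f : res R B ⟶ (res R B)⟦i⟧, capChain f d η = (homologyShiftIso R B i d).hom
      ((tensorHomologyIso R B d).hom.app _
        (yonedaEval (tensorHomology R B d) (resClass η) _ (Z.map f))) := by
    intro f
    rw [capChain_eq_comp, yonedaEval_resClass]
    refine congrArg (homologyShiftIso R B i d).hom ?_
    exact (ConcreteCategory.congr_hom ((tensorHomologyIso R B d).inv_hom_id_app ((res R B)⟦i⟧))
      (HomologicalComplex.homologyMap ((tensorFunctor R B).map f) (-d) η)).symm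
  have inj : Function.Injective ((homologyShiftIso R B i d).hom) :=
    (ModuleCat.mono_iff_injective _).1 inferInstance
  have inj' : Function.Injective ((tensorHomologyIso R B d).hom.app ((res R B)⟦i⟧)) :=
    (ModuleCat.mono_iff_injective _).1 inferInstance
  have surj : Function.Surjective ((homologyShiftIso R B i d).hom) :=
    (ModuleCat.epi_iff_surjective _).1 inferInstance
  have surj' : Function.Surjective ((tensorHomologyIso R B d).hom.app ((res R B)⟦i⟧)) :=
    (ModuleCat.epi_iff_surjective _).1 inferInstance
  constructor
  · intro μ ν hμν
    obtain ⟨f, hf⟩ := exists_represents μ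
    obtain ⟨g, hg⟩ := exists_represents ν
    change cap μ η = cap ν η at hμν
    rw [cap_eq hf, cap_eq hg, key, key] at hμν
    have hfg : Z.map f = Z.map g := hb.1 (inj' (inj hμν))
    have hQ : DerivedCategory.Q.map f = DerivedCategory.Q.map g :=
      DerivedCategory.Q_map_eq_of_homotopy _ (HomotopyCategory.homotopyOfEq _ _ hfg)
    rw [← cancel_epi (resIso R B).hom, ← hf, ← hg, ShiftedHom.map, ShiftedHom.map, hQ]
  · intro y
    obtain ⟨y, rfl⟩ := surj y
    obtain ⟨y, rfl⟩ := surj' y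
    obtain ⟨f', rfl⟩ := hb.2 y
    obtain ⟨f, rfl⟩ := Z.map_surjective f'
    obtain ⟨μ, hμ⟩ := exists_represented f
    exact ⟨μ, (cap_eq hμ η).trans (key f)⟩

/-- `Σ^i B` sits in degree `-i > 0`, and the derived category has no nonzero maps from a complex in
degrees `≤ 0` to one in degrees `≥ -i`. -/
lemma subsingleton_HHupper_of_neg {i : ℤ} (hi : i < 0) : Subsingleton (HHupper R B i) := by
  have := DerivedCategory.subsingleton_hom_of_isStrictlyLE_of_isStrictlyGE
    ((CochainComplex.singleFunctor _ 0).obj (diag R B))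
    ((CochainComplex.singleFunctor _ (-i)).obj (diag R B)) 0 (-i) (by omega)
  have e₁ := (DerivedCategory.singleFunctorIsoCompQ _ 0).app (diag R B)
  have e₂ : (diagD R B)⟦i⟧ ≅ DerivedCategory.Q.obj
      ((CochainComplex.singleFunctor _ (-i)).obj (diag R B)) :=
    ((DerivedCategory.singleFunctors _).shiftIso i (-i) 0 (by omega)).app (diag R B) ≪≫
      (DerivedCategory.singleFunctorIsoCompQ _ (-i)).app (diag R B)
  exact @Equiv.subsingleton _ _ (e₁.homCongr e₂) this

end Cap

end HochschildDuality

end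

/-! ### Poincaré duality and the vanishing range -/

open HochschildDuality
theorem proposition5p5 {R : Type u} [CommRing R] {B : Type v} [Ring B] [Algebra R B]
    [HasDerivedCategory.{w} (ModuleCat.{v} (Env R B))]
    (d : ℤ) (η : HHlower R B d) (hη : IsCalabiYau η) :
    (∀ i : ℤ, ∃ e : HHupper R B i ≃ₗ[R] HHlower R B (d - i),
      ∀ μ : HHupper R B i, e μ = cap μ η) ∧
    (∀ i : ℤ, i ∉ Set.Icc 0 d → Subsingleton (HHupper R B i)) ∧
    (∀ i : ℤ, i ∉ Set.Icc 0 d → Subsingleton (HHlower R B i)) := by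
  let e (i : ℤ) : HHupper R B i ≃ₗ[R] HHlower R B (d - i) :=
    LinearEquiv.ofBijective (capLinear η i) (capLinear_bijective hη i)
  refine ⟨fun i => ⟨e i, fun μ => rfl⟩, fun i hi => ?_, fun i hi => ?_⟩
  · by_cases h0 : i < 0
    · exact subsingleton_HHupper_of_neg h0
    -- Above `d`, duality identifies `HH^i` with `HH_{d-i}`, of negative degree.
    · have hd : d < i := by
        by_contra h
        exact hi ⟨by omega, by omega⟩
      have := subsingleton_HHlower_of_neg (R := R) (B := B) (i := d - i) (by omega)
      exact (e i).toEquiv.subsingleton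
  · by_cases h0 : i < 0
    · exact subsingleton_HHlower_of_neg h0
    · have hd : d < i := by
        by_contra h
        exact hi ⟨by omega, by omega⟩
      -- Here `j = d - i` is negative, so the dual group `HH^j` vanishes.
      obtain ⟨j, rfl⟩ : ∃ j, i = d - j := ⟨d - i, by omega⟩
      have := subsingleton_HHupper_of_neg (R := R) (B := B) (i := j) (by omega)
      exact (e j).symm.toEquiv.subsingleton
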